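/- **Setting.** Let $d\in\mathbb{N}$, let $(\Omega,\mathcal F,P)$ be a complete probability space with a filtration $\{\mathcal F_t\}_{t\ge 0}$ satisfying the usual conditions (right continuous, $\mathcal F_0$ contains all $P$-null sets), and let $S$ be the unit sphere of $\mathbb{R}^d$. $\mathcal{F}_{kc}(\mathbb{R}^d)$ is the family of fuzzy sets $\nu:\mathbb{R}^d\to[0,1]$ such that $\nu_\alpha=\{\nu\ge\alpha\}$ is closed for $\alpha\in(0,1]$ and convex for $\alpha\in[0,1]$, $\nu_1\neq\emptyset$, and the support $\nu_{0+}=\overline{\{\nu>0\}}$ is compact. For $a\in\mathbb{R}^d$, $\mathbf 1_a\in\mathcal{F}_{kc}(\mathbb{R}^d)$ is the indicator function of $\{a\}$. The support function of $\nu$ is $s_\nu(x,\alpha)=\sup_{a\in\nu_\alpha}\langle x,a\rangle$ for $\alpha\in(0,1]$ and $s_\nu(x,0)=\sup_{a\in\nu_{0+}}\langle x,a\rangle$, $x\in S$. The map $\nu\mapsto s_\nu$ embeds $\mathcal{F}_{kc}(\mathbb{R}^d)$ into the Banach space $\overline{\mathbf C}=\overline C([0,1],C(S))$ of bounded functions $[0,1]\to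 C(S)$ that are left continuous on $(0,1]$, right continuous at $0$ and have right limits on $(0,1)$, with the norm $\sup_\alpha\|f(\alpha)\|_{C(S)}$. An (adapted) fuzzy set-valued process is a family of maps $B_t:\Omega\to\mathcal{F}_{kc}(\mathbb{R}^d)$, $t\ge0$, such that for all $t\ge 0$ and $\alpha\in(0,1]$ the map $\omega\mapsto B_t(\omega)_\alpha$ is $\mathcal F_t$-measurable with respect to the Borel $\sigma$-algebra of the Hausdorff metric on nonempty compact sets. A *Brownian motion* (or *Wiener process*) in a real normed space $E$ is a family of maps $W_t:\Omega\to E$, $t\ge0$, such that (i) $W_0=0$ a.s.; (ii) $t\mapsto W_t$ is a.s. continuous; (iii) for every continuous linear functional $f\in E^*$ there is $v_f\ge0$ such that, for all $0\le s\le t$, $f(W_t-W_s)$ is a real random variable with law $N(0,(t-s)v_f)$; (iv) for all $n$ and $f_1,\dots,f_n\in E^*$ the $\mathbb{R}^n$-valued process $(f_1(W_t),\dots,f_n(W_t))_{t\ge0}$ has independent increments. (Thus the covariance form of $W_1$ is arbitrary; in $E=\mathbb{R}^d$ these are the centered Wiener processes with an arbitrary, possibly degenerate, covariance matrix.) An adapted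 fuzzy set-valued process $\{B_t\}$ is called a *fuzzy set-valued Brownian motion* if $\{s_{B_t}\}_{t\ge0}$ is a Brownian motion in $\overline{\mathbf C}$. **Theorem.** An adapted fuzzy set-valued process $\{B_t:t\ge0\}$ is a fuzzy set-valued Brownian motion if and only if there is a Wiener process $\{b_t:t\ge0\}$ in $\mathbb{R}^d$ such that, almost surely, $B_t=\mathbf 1_{b_t}$ for all $t\ge0$. -/

import Mathlib

open MeasureTheory ProbabilityTheory Set Filter Topology
open scoped NNReal ENNReal

noncomputable section

namespace FuzzyBM

/-- The space `ℝ^d` with its Euclidean structure. -/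
abbrev Eu (d : ℕ) : Type := EuclideanSpace ℝ (Fin d)

/-- The unit sphere of `ℝ^d`. -/
abbrev USphere (d : ℕ) : Type := Metric.sphere (0 : Eu d) 1

/-! ### Fuzzy sets -/

/-- The family `F_kc(ℝ^d)`: fuzzy sets `ν : ℝ^d → [0,1]` that are upper semicontinuous (closed
cuts), normal (nonempty `1`-cut), with compact support and convex cuts. -/
structure FuzzyKC (d : ℕ) where
  toFun : Eu d → ℝ
  mem_Icc : ∀ x, toFun x ∈ Icc (0 : ℝ) 1
  isClosed_cut : ∀ α ∈ Ioc (0 : ℝ) 1, IsClosed {x | α ≤ toFun x}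
  nonempty_cut_one : {x | toFun x = 1}.Nonempty
  isCompact_support : IsCompact (closure {x | 0 < toFun x})
  convex_cut : ∀ α ∈ Icc (0 : ℝ) 1, Convex ℝ {x | α ≤ toFun x}

/-- The underlying set of the `α`-level of `ν`: the cut `{ν ≥ α}` if `α > 0`, and the support
`closure {ν > 0}` if `α = 0`. -/
def FuzzyKC.levelSet {d : ℕ} (ν : FuzzyKC d) (α : unitInterval) : Set (Eu d) :=
  if α = 0 then closure {x | 0 < ν.toFun x} else {x | (α : ℝ) ≤ ν.toFun x}

theorem FuzzyKC.levelSet_zero {d : ℕ} (ν : FuzzyKC d) :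
    ν.levelSet 0 = closure {x | 0 < ν.toFun x} := if_pos rfl

theorem FuzzyKC.levelSet_of_pos {d : ℕ} (ν : FuzzyKC d) {α : unitInterval} (h : 0 < α) :
    ν.levelSet α = {x | (α : ℝ) ≤ ν.toFun x} := if_neg h.ne'

theorem FuzzyKC.levelSet_subset_zero {d : ℕ} (ν : FuzzyKC d) (α : unitInterval) :
    ν.levelSet α ⊆ ν.levelSet 0 := by
  rcases eq_or_lt_of_le (unitInterval.nonneg' (t := α)) with h | h
  · rw [← h]
  · rw [ν.levelSet_of_pos h, ν.levelSet_zero]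
    have h' : (0 : ℝ) < α := h
    exact fun x hx => subset_closure (lt_of_lt_of_le h' hx)

theorem FuzzyKC.isCompact_levelSet {d : ℕ} (ν : FuzzyKC d) (α : unitInterval) :
    IsCompact (ν.levelSet α) := by
  rcases eq_or_lt_of_le (unitInterval.nonneg' (t := α)) with h | h
  · rw [← h, ν.levelSet_zero]; exact ν.isCompact_support
  · refine IsCompact.of_isClosed_subset (s := ν.levelSet 0) ?_ ?_ (ν.levelSet_subset_zero α)
    · rw [ν.levelSet_zero]; exact ν.isCompact_support
    · rw [ν.levelSet_of_pos h]; exact ν.isClosed_cut α ⟨h, α.2.2⟩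

theorem FuzzyKC.nonempty_levelSet {d : ℕ} (ν : FuzzyKC d) (α : unitInterval) :
    (ν.levelSet α).Nonempty := by
  obtain ⟨x, hx⟩ := ν.nonempty_cut_one
  have hx1 : ν.toFun x = 1 := hx
  refine ⟨x, ?_⟩
  rcases eq_or_lt_of_le (unitInterval.nonneg' (t := α)) with h | h
  · rw [← h, ν.levelSet_zero]
    refine subset_closure ?_
    simp [hx1]
  · rw [ν.levelSet_of_pos h]
    simpa [hx1] using α.2.2

/-- The `α`-level of `ν` as a nonempty compact set. Mathlib's metric on `NonemptyCompacts` is the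
Hausdorff metric. -/
def FuzzyKC.level {d : ℕ} (ν : FuzzyKC d) (α : unitInterval) :
    TopologicalSpace.NonemptyCompacts (Eu d) where
  carrier := ν.levelSet α
  isCompact' := ν.isCompact_levelSet α
  nonempty' := ν.nonempty_levelSet α

open Classical in
/-- The indicator `1_a` of the singleton `{a}`, as a fuzzy set. -/
def FuzzyKC.indicator {d : ℕ} (a : Eu d) : FuzzyKC d where
  toFun x := if x = a then 1 else 0
  mem_Icc x := by split_ifs <;> simp
  isClosed_cut α hα := by
    have : {x : Eu d | α ≤ if x = a then (1 : ℝ) else 0} = {a} := by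
      ext x
      by_cases h : x = a
      · simp [h, hα.2]
      · simp [h, hα.1]
    rw [this]
    exact isClosed_singleton
  nonempty_cut_one := ⟨a, by simp⟩
  isCompact_support := by
    have : {x : Eu d | 0 < if x = a then (1 : ℝ) else 0} = {a} := by
      ext x
      by_cases h : x = a <;> simp [h]
    rw [this, closure_singleton]
    exact isCompact_singleton
  convex_cut α hα := by
    rcases eq_or_lt_of_le hα.1 with h | h
    · have : {x : Eu d | α ≤ if x = a then (1 : ℝ) else 0} = univ := by
        ext x
        by_cases h' : x = a <;> simp [h', ← h]
      rw [this]
      exact convex_univ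
    · have : {x : Eu d | α ≤ if x = a then (1 : ℝ) else 0} = {a} := by
        ext x
        by_cases h' : x = a
        · simp [h', hα.2]
        · simp [h', h]
      rw [this]
      exact convex_singleton a

/-! ### The space `C̄([0,1], C(S))` -/

/-- The Banach space `C̄([0,1], C(S))` of bounded functions `f : [0,1] → C(S)` that are left
continuous on `(0,1]`, right continuous at `0` and have right limits on `(0,1)`, with the norm
`sup_α ‖f α‖`. The ambient `lp … ∞` is the space of all bounded functions with the sup norm. -/
def Cbar (d : ℕ) : Submodule ℝ (lp (fun _ : unitInterval => C(USphere d, ℝ)) ∞) where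
  carrier := {f |
    (∀ α : unitInterval, 0 < α → Tendsto (fun β => f β) (𝓝[<] α) (𝓝 (f α))) ∧
    Tendsto (fun β => f β) (𝓝[>] (0 : unitInterval)) (𝓝 (f 0)) ∧
    ∀ α : unitInterval, 0 < α → α < 1 →
      ∃ l : C(USphere d, ℝ), Tendsto (fun β => f β) (𝓝[>] α) (𝓝 l)}
  add_mem' := by
    rintro f g ⟨hf1, hf2, hf3⟩ ⟨hg1, hg2, hg3⟩
    refine ⟨fun α hα => (hf1 α hα).add (hg1 α hα), hf2.add hg2, fun α h0 h1 => ?_⟩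
    obtain ⟨l, hl⟩ := hf3 α h0 h1
    obtain ⟨m, hm⟩ := hg3 α h0 h1
    exact ⟨l + m, hl.add hm⟩
  zero_mem' := ⟨fun _ _ => tendsto_const_nhds, tendsto_const_nhds,
    fun _ _ _ => ⟨0, tendsto_const_nhds⟩⟩
  smul_mem' := by
    rintro c f ⟨hf1, hf2, hf3⟩
    refine ⟨fun α hα => (hf1 α hα).const_smul c, hf2.const_smul c, fun α h0 h1 => ?_⟩
    obtain ⟨l, hl⟩ := hf3 α h0 h1
    exact ⟨c • l, hl.const_smul c⟩

/-! ### Support functions and the embedding -/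

/-- The support function `x ↦ sup {⟨x, a⟩ : a ∈ K}` of a nonempty compact set, on the sphere. -/
def suppC {d : ℕ} (K : TopologicalSpace.NonemptyCompacts (Eu d)) : C(USphere d, ℝ) where
  toFun x := sSup ((fun a : Eu d => inner ℝ (x : Eu d) a) '' (K : Set (Eu d)))
  continuous_toFun := by
    refine IsCompact.continuous_sSup (f := fun (x : USphere d) (a : Eu d) => inner ℝ (x : Eu d) a)
      K.isCompact ?_
    exact Continuous.inner (continuous_subtype_val.comp continuous_fst) continuous_snd

theorem suppC_le_add {d : ℕ} {K L : TopologicalSpace.NonemptyCompacts (Eu d)} {r : ℝ}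
    (h : ∀ a ∈ (K : Set (Eu d)), ∃ b ∈ (L : Set (Eu d)), dist a b ≤ r) (x : USphere d) :
    suppC K x ≤ suppC L x + r := by
  refine csSup_le (K.nonempty.image _) ?_
  rintro _ ⟨a, ha, rfl⟩
  obtain ⟨b, hb, hab⟩ := h a ha
  have hbdd : BddAbove ((fun a : Eu d => inner ℝ (x : Eu d) a) '' (L : Set (Eu d))) :=
    (L.isCompact.image (by fun_prop)).bddAbove
  have h1 : inner ℝ (x : Eu d) b ≤ suppC L x := le_csSup hbdd ⟨b, hb, rfl⟩
  have h2 : inner ℝ (x : Eu d) (a - b) ≤ ‖(x : Eu d)‖ * ‖a - b‖ := real_inner_le_norm _ _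
  have hx : ‖(x : Eu d)‖ = 1 := by simp
  rw [hx, one_mul, ← dist_eq_norm, inner_sub_right] at h2
  show inner ℝ (x : Eu d) a ≤ _
  linarith

theorem dist_suppC_le {d : ℕ} {K L : TopologicalSpace.NonemptyCompacts (Eu d)} {r : ℝ}
    (hr : 0 ≤ r) (h : ∀ a ∈ (K : Set (Eu d)), ∃ b ∈ (L : Set (Eu d)), dist a b ≤ r)
    (h' : ∀ a ∈ (L : Set (Eu d)), ∃ b ∈ (K : Set (Eu d)), dist a b ≤ r) :
    dist (suppC K) (suppC L) ≤ r := by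
  rw [ContinuousMap.dist_le hr]
  intro x
  rw [Real.dist_eq, abs_le]
  constructor <;> linarith [suppC_le_add h x, suppC_le_add h' x]

theorem tendsto_suppC_left {d : ℕ} (ν : FuzzyKC d) {α : unitInterval} (hα : 0 < α) :
    Tendsto (fun β => suppC (ν.level β)) (𝓝[<] α) (𝓝 (suppC (ν.level α))) := by
  rw [Metric.tendsto_nhds]
  intro ε hε
  have key : ∃ β : Iio α, ν.levelSet β ⊆ Metric.thickening (ε / 2) (ν.levelSet α) := by
    have : Nonempty (Iio α) := ⟨⟨0, hα⟩⟩
    have hanti : ∀ β γ : unitInterval, β ≤ γ → ν.levelSet γ ⊆ ν.levelSet β := by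
      intro β γ h
      rcases eq_or_lt_of_le (unitInterval.nonneg' (t := β)) with h0 | h0
      · rw [← h0]; exact ν.levelSet_subset_zero γ
      · rw [ν.levelSet_of_pos h0, ν.levelSet_of_pos (h0.trans_le h)]
        exact fun x hx => le_trans (show (β : ℝ) ≤ γ from h) hx
    refine exists_subset_nhds_of_isCompact (V := fun β : Iio α => ν.levelSet β) ?_
      (fun β => ν.isCompact_levelSet β) ?_
    · intro β γ
      exact ⟨max β γ, hanti _ _ (le_max_left (β : unitInterval) γ),
        hanti _ _ (le_max_right (β : unitInterval) γ)⟩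
    · intro x hx
      refine Metric.isOpen_thickening.mem_nhds (Metric.self_subset_thickening (by positivity) _ ?_)
      rw [ν.levelSet_of_pos hα]
      show (α : ℝ) ≤ ν.toFun x
      refine le_of_forall_lt fun c hc => ?_
      have hα' : (0 : ℝ) < α := hα
      obtain ⟨c', hc1, hc2⟩ := exists_between (max_lt hc hα')
      have hc0 : 0 < c' := (le_max_right c 0).trans_lt hc1
      let β : unitInterval := ⟨c', hc0.le, hc2.le.trans α.2.2⟩
      have hβ : x ∈ ν.levelSet β := mem_iInter.1 hx ⟨β, hc2⟩
      rw [ν.levelSet_of_pos (show (0 : unitInterval) < β from hc0)] at hβ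
      exact ((le_max_left c 0).trans_lt hc1).trans_le hβ
  obtain ⟨⟨β₀, hβ₀⟩, hsub⟩ := key
  filter_upwards [Ioo_mem_nhdsLT hβ₀] with β hβ
  have hβ0 : 0 < β := unitInterval.nonneg'.trans_lt hβ.1
  refine (dist_suppC_le (r := ε / 2) (by positivity) ?_ ?_).trans_lt (by linarith)
  · intro a ha
    have : a ∈ ν.levelSet β₀ := by
      rcases eq_or_lt_of_le (unitInterval.nonneg' (t := β₀)) with h0 | h0
      · rw [← h0]; exact ν.levelSet_subset_zero β ha
      · have ha' : a ∈ ν.levelSet β := ha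
        rw [ν.levelSet_of_pos hβ0] at ha'
        rw [ν.levelSet_of_pos h0]
        exact le_trans (show (β₀ : ℝ) ≤ β from hβ.1.le) ha'
    obtain ⟨b, hb, hab⟩ := Metric.mem_thickening_iff.1 (hsub this)
    exact ⟨b, hb, hab.le⟩
  · intro a ha
    have ha' : a ∈ ν.levelSet α := ha
    rw [ν.levelSet_of_pos hα] at ha'
    refine ⟨a, ?_, by simpa using by positivity⟩
    show a ∈ ν.levelSet β
    rw [ν.levelSet_of_pos hβ0]
    exact le_trans (show (β : ℝ) ≤ α from hβ.2.le) ha'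

theorem tendsto_suppC_right {d : ℕ} (ν : FuzzyKC d) {α : unitInterval} (hα : α < 1)
    (L : TopologicalSpace.NonemptyCompacts (Eu d))
    (hL : (L : Set (Eu d)) = closure {x | (α : ℝ) < ν.toFun x}) :
    Tendsto (fun β => suppC (ν.level β)) (𝓝[>] α) (𝓝 (suppC L)) := by
  rw [Metric.tendsto_nhds]
  intro ε hε
  have key : ∃ β : Ioi α, (L : Set (Eu d)) ⊆
      Metric.thickening (ε / 2) {x | (β : ℝ) ≤ ν.toFun x} := by
    have : Nonempty (Ioi α) := ⟨⟨1, hα⟩⟩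
    refine L.isCompact.elim_directed_cover
      (fun β : Ioi α => Metric.thickening (ε / 2) {x | (β : ℝ) ≤ ν.toFun x})
      (fun _ => Metric.isOpen_thickening) ?_ ?_
    · rw [hL]
      intro x hx
      obtain ⟨y, hy, hxy⟩ := Metric.mem_closure_iff.1 hx (ε / 2) (by positivity)
      refine mem_iUnion.2 ⟨⟨⟨ν.toFun y, ν.mem_Icc y⟩, hy⟩, ?_⟩
      exact Metric.mem_thickening_iff.2 ⟨y, le_refl (ν.toFun y), hxy⟩
    · intro β γ
      refine ⟨min β γ, Metric.thickening_subset_of_subset _ fun x (hx : _ ≤ ν.toFun x) => ?_,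
        Metric.thickening_subset_of_subset _ fun x (hx : _ ≤ ν.toFun x) => ?_⟩
      · have h : (min β γ : Ioi α) ≤ β := min_le_left _ _
        have h' : (((min β γ : Ioi α) : unitInterval) : ℝ) ≤ ((β : unitInterval) : ℝ) := h
        exact h'.trans hx
      · have h : (min β γ : Ioi α) ≤ γ := min_le_right _ _
        have h' : (((min β γ : Ioi α) : unitInterval) : ℝ) ≤ ((γ : unitInterval) : ℝ) := h
        exact h'.trans hx
  obtain ⟨⟨β₀, hβ₀⟩, hsub⟩ := key
  filter_upwards [Ioo_mem_nhdsGT hβ₀] with β hβ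
  have hβ0 : 0 < β := unitInterval.nonneg'.trans_lt hβ.1
  refine (dist_suppC_le (r := ε / 2) (by positivity) ?_ ?_).trans_lt (by linarith)
  · intro a ha
    have ha' : a ∈ ν.levelSet β := ha
    rw [ν.levelSet_of_pos hβ0] at ha'
    refine ⟨a, ?_, by simpa using by positivity⟩
    rw [hL]
    exact subset_closure (lt_of_lt_of_le (show (α : ℝ) < β from hβ.1) ha')
  · intro a ha
    obtain ⟨b, hb, hab⟩ := Metric.mem_thickening_iff.1 (hsub ha)
    refine ⟨b, ?_, hab.le⟩
    show b ∈ ν.levelSet β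
    rw [ν.levelSet_of_pos hβ0]
    exact le_trans (show (β : ℝ) ≤ β₀ from hβ.2.le) hb

theorem memℓp_suppC {d : ℕ} (ν : FuzzyKC d) :
    Memℓp (fun α : unitInterval => suppC (ν.level α)) ∞ := by
  obtain ⟨R, hR⟩ := (ν.isCompact_levelSet 0).isBounded.exists_norm_le
  have hR0 : 0 ≤ R := by
    obtain ⟨a, ha⟩ := ν.nonempty_levelSet 0
    exact (norm_nonneg a).trans (hR a ha)
  refine memℓp_infty ⟨R, ?_⟩
  rintro _ ⟨α, rfl⟩
  refine (ContinuousMap.norm_le _ hR0).2 fun x => ?_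
  obtain ⟨a, ha, hax⟩ := (ν.level α).isCompact.exists_sSup_image_eq (ν.level α).nonempty
    (f := fun a : Eu d => inner ℝ (x : Eu d) a) (by fun_prop)
  have hx : ‖(x : Eu d)‖ = 1 := by simp
  have h1 : suppC (ν.level α) x = inner ℝ (x : Eu d) a := hax
  rw [h1]
  refine (norm_inner_le_norm _ _).trans ?_
  rw [hx, one_mul]
  exact hR a (ν.levelSet_subset_zero α ha)

theorem suppC_mem_Cbar {d : ℕ} (ν : FuzzyKC d) :
    (⟨fun α : unitInterval => suppC (ν.level α), memℓp_suppC ν⟩ :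
      lp (fun _ : unitInterval => C(USphere d, ℝ)) ∞) ∈ Cbar d := by
  refine ⟨fun α hα => tendsto_suppC_left ν hα, ?_, fun α h0 h1 => ?_⟩
  · refine tendsto_suppC_right ν zero_lt_one (ν.level 0) ?_
    exact ν.levelSet_zero
  · have hsub : closure {x | (α : ℝ) < ν.toFun x} ⊆ ν.levelSet 0 := by
      rw [ν.levelSet_zero]
      exact closure_mono fun x hx => lt_trans (show (0 : ℝ) < α from h0) hx
    obtain ⟨y, hy⟩ := ν.nonempty_cut_one
    have hy1 : ν.toFun y = 1 := hy
    let L : TopologicalSpace.NonemptyCompacts (Eu d) :=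
      { carrier := closure {x | (α : ℝ) < ν.toFun x}
        isCompact' := (ν.isCompact_levelSet 0).of_isClosed_subset isClosed_closure hsub
        nonempty' := ⟨y, subset_closure (by
          show (α : ℝ) < ν.toFun y
          rw [hy1]
          exact h1)⟩ }
    exact ⟨suppC L, tendsto_suppC_right ν h1 L rfl⟩

/-- The embedding `j(ν) = s_ν` of `F_kc(ℝ^d)` into `C̄([0,1], C(S))` by support functions:
`s_ν(x, α)` is the value at `x` of the support function of the `α`-level of `ν`. -/
def FuzzyKC.supp {d : ℕ} (ν : FuzzyKC d) : Cbar d :=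
  ⟨⟨fun α => suppC (ν.level α), memℓp_suppC ν⟩, suppC_mem_Cbar ν⟩

/-! ### Fuzzy random variables and processes -/

/-- `X : Ω → F_kc(ℝ^d)` is a fuzzy set-valued random variable with respect to the σ-algebra `m`:
each level map `ω ↦ X(ω)_α`, `α ∈ (0,1]`, is measurable for the Borel σ-algebra of the Hausdorff
metric. -/
def IsFuzzyRV {Ω : Type*} {d : ℕ} (m : MeasurableSpace Ω) (X : Ω → FuzzyKC d) : Prop :=
  ∀ α : unitInterval, 0 < α →
    @Measurable Ω (TopologicalSpace.NonemptyCompacts (Eu d)) m (borel _) (fun ω => (X ω).level α)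

/-- The usual conditions: `𝓕` is right continuous and `𝓕 0` contains every `P`-null set. -/
structure UsualConditions {Ω : Type*} {mΩ : MeasurableSpace Ω} (𝓕 : Filtration ℝ≥0 mΩ)
    (P : Measure Ω) : Prop where
  rightCont : ∀ t, ⨅ s : Ioi t, 𝓕 s = 𝓕 t
  complete : ∀ N : Set Ω, P N = 0 → MeasurableSet[𝓕 0] N

/-- An adapted fuzzy set-valued stochastic process. -/
def IsAdaptedFuzzyProcess {Ω : Type*} {mΩ : MeasurableSpace Ω} {d : ℕ} (𝓕 : Filtration ℝ≥0 mΩ)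
    (X : ℝ≥0 → Ω → FuzzyKC d) : Prop :=
  ∀ t, IsFuzzyRV (𝓕 t) (X t)

/-! ### Brownian motion -/

/-- A Brownian motion (Wiener process) in a real normed space `E`: it starts at `0`, has almost
surely continuous paths, its increments are independent, and each increment `W t - W s` is a
centered Gaussian random element with covariance `(t - s) Q`, where the covariance form `Q` on
the dual of `E` is arbitrary. As usual in a normed space that need not be separable, random
elements, their independence and Gaussianity are understood through continuous linear functionals:
`v` below is `Q f f`, and `Q` is determined by its diagonal. -/
structure IsBrownianMotion {Ω E : Type*} {mΩ : MeasurableSpace Ω} [NormedAddCommGroup E]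
    [NormedSpace ℝ E] (W : ℝ≥0 → Ω → E) (P : Measure Ω) : Prop where
  zero : ∀ᵐ ω ∂P, W 0 ω = 0
  continuous_paths : ∀ᵐ ω ∂P, Continuous fun t => W t ω
  gaussian : ∀ f : StrongDual ℝ E, ∃ v : ℝ≥0, ∀ s t : ℝ≥0, s ≤ t →
    HasLaw (fun ω => f (W t ω - W s ω)) (gaussianReal 0 ((t - s) * v)) P
  indep : ∀ (n : ℕ) (f : Fin n → StrongDual ℝ E),
    HasIndepIncrements (fun (t : ℝ≥0) ω (i : Fin n) => f i (W t ω)) P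

/-- A fuzzy set-valued Brownian motion: an adapted fuzzy set-valued process whose support function
process is a Brownian motion in `C̄([0,1], C(S))`. -/
def IsFuzzyBrownianMotion {Ω : Type*} {mΩ : MeasurableSpace Ω} {d : ℕ} (𝓕 : Filtration ℝ≥0 mΩ)
    (B : ℝ≥0 → Ω → FuzzyKC d) (P : Measure Ω) : Prop :=
  IsAdaptedFuzzyProcess 𝓕 B ∧ IsBrownianMotion (fun t ω => (B t ω).supp) P

end FuzzyBM

end

/-! The width of a nonempty compact set in direction `x`, namely `s(x) + s(-x)`, is nonnegative. At
level `0` it is a continuous linear functional of the support function. Along a Brownian motion in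
`Cbar d` such a functional is a centered Gaussian variable at each time; being nonnegative with mean
zero, it vanishes almost surely, and path continuity makes it vanish at all times at once
(`ae_eq_zero_of_nonneg`). Zero width of the support in the `d` coordinate directions leaves a single
point, so `B t ω` is the indicator of that point (`eq_indicator_of_width_eq_zero`).

The remaining content is that continuous linear maps preserve Brownian motions (`map`). The point is
read off from the support function by the linear map `coordVec`, which makes it a Wiener process in
`ℝ^d`. Conversely, the support function of a point is linear in the point, so `pointSupp` carries a
Wiener process to a Brownian motion in `Cbar d`. -/

namespace FuzzyBM

namespace IsBrownianMotion

variable {Ω E F : Type*} {mΩ : MeasurableSpace Ω} {P : Measure Ω}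
  [NormedAddCommGroup E] [NormedSpace ℝ E] [NormedAddCommGroup F] [NormedSpace ℝ F]

/-- Laws and independence are tested on functionals only, and a functional `f` on `F` pulls back to
`f.comp T` on `E`. -/
theorem map {W : ℝ≥0 → Ω → E} (hW : IsBrownianMotion W P) (T : E →L[ℝ] F) :
    IsBrownianMotion (fun t ω => T (W t ω)) P where
  zero := by
    filter_upwards [hW.zero] with ω h
    rw [h, map_zero]
  continuous_paths := by
    filter_upwards [hW.continuous_paths] with ω h
    exact T.continuous.comp h
  gaussian f := by
    obtain ⟨v, hv⟩ := hW.gaussian (f.comp T)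
    refine ⟨v, fun s t hst => ?_⟩
    simpa using hv s t hst
  indep n f := hW.indep n fun i => (f i).comp T

/-- The exceptional null set must not depend on `t`: agreement at each fixed time would not transfer
path continuity. -/
theorem congr {W W' : ℝ≥0 → Ω → E} (hW : IsBrownianMotion W P)
    (h : ∀ᵐ ω ∂P, ∀ t, W t ω = W' t ω) : IsBrownianMotion W' P where
  zero := by
    filter_upwards [hW.zero, h] with ω h0 h1
    rw [← h1, h0]
  continuous_paths := by
    filter_upwards [hW.continuous_paths, h] with ω h0 h1
    simpa only [h1] using h0
  gaussian f := by
    obtain ⟨v, hv⟩ := hW.gaussian f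
    refine ⟨v, fun s t hst => (hv s t hst).congr ?_⟩
    filter_upwards [h] with ω h1
    rw [h1, h1]
  indep n f m t ht := by
    refine (iIndepFun_congr fun i => ?_).1 (hW.indep n f m t ht)
    filter_upwards [h] with ω h1
    simp only [h1]

/-- A functional which is nonnegative along a Brownian motion vanishes along it. -/
theorem ae_eq_zero_of_nonneg {W : ℝ≥0 → Ω → E} (hW : IsBrownianMotion W P) (f : StrongDual ℝ E)
    (hf : ∀ t ω, 0 ≤ f (W t ω)) : ∀ᵐ ω ∂P, ∀ t, f (W t ω) = 0 := by
  obtain ⟨v, hv⟩ := hW.gaussian f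
  have hfix : ∀ t, ∀ᵐ ω ∂P, f (W t ω) = 0 := by
    intro t
    -- The Gaussian hypothesis concerns increments; the one from time `0` is `W t` itself, since `W
    -- 0 = 0` almost surely.
    have hlaw : HasLaw (fun ω => f (W t ω)) (gaussianReal 0 ((t - 0) * v)) P := by
      refine (hv 0 t zero_le).congr ?_
      filter_upwards [hW.zero] with ω h
      simp [h]
    have hint : Integrable (fun ω => f (W t ω)) P := by
      have h1 : Integrable id (P.map fun ω => f (W t ω)) := by
        rw [hlaw.map_eq]
        exact memLp_one_iff_integrable.1 (memLp_id_gaussianReal 1)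
      exact h1.comp_aemeasurable hlaw.aemeasurable
    have h0 : ∫ ω, f (W t ω) ∂P = 0 := by
      rw [hlaw.integral_eq, integral_id_gaussianReal]
    exact (integral_eq_zero_iff_of_nonneg (hf t) hint).1 h0
  -- The null sets for `t` in a countable dense set have a null union; off it, a continuous path
  -- vanishing on a dense set vanishes everywhere.
  obtain ⟨D, hDc, hDd⟩ := TopologicalSpace.exists_countable_dense ℝ≥0
  filter_upwards [(ae_ball_iff hDc).2 fun t _ => hfix t, hW.continuous_paths] with ω h hc
  exact fun t => congrFun ((f.continuous.comp hc).ext_on hDd continuous_const h) t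

end IsBrownianMotion

/-! ### Functionals on `Cbar d` and the width of a compact set -/

/-- Evaluation at level `α` and direction `x`, as a functional on `Cbar d`. -/
noncomputable def evalFunctional {d : ℕ} (α : unitInterval) (x : USphere d) : StrongDual ℝ (Cbar d) :=
  (ContinuousMap.evalCLM ℝ x).comp
    ((lp.evalCLM ℝ (fun _ : unitInterval => C(USphere d, ℝ)) ∞ α).comp (Cbar d).subtypeL)

theorem evalFunctional_supp {d : ℕ} (ν : FuzzyKC d) (α : unitInterval) (x : USphere d) :
    evalFunctional α x ν.supp = suppC (ν.level α) x := rfl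

theorem ext_evalFunctional {d : ℕ} {f g : Cbar d}
    (h : ∀ α x, evalFunctional α x f = evalFunctional α x g) : f = g := by
  apply Subtype.ext
  apply lp.ext
  funext α
  exact ContinuousMap.ext fun x => h α x

theorem inner_le_suppC {d : ℕ} (K : TopologicalSpace.NonemptyCompacts (Eu d)) (x : USphere d)
    {a : Eu d} (ha : a ∈ (K : Set (Eu d))) : inner ℝ (x : Eu d) a ≤ suppC K x :=
  le_csSup (K.isCompact.image (by fun_prop)).bddAbove ⟨a, ha, rfl⟩

/-- Any point `a` of `K` contributes `⟨x, a⟩` to one term and `-⟨x, a⟩` to the other. -/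
theorem suppC_add_suppC_neg_nonneg {d : ℕ} (K : TopologicalSpace.NonemptyCompacts (Eu d))
    (x : USphere d) : 0 ≤ suppC K x + suppC K (-x) := by
  obtain ⟨a, ha⟩ := K.nonempty
  have h1 := inner_le_suppC K x ha
  have h2 := inner_le_suppC K (-x) ha
  rw [coe_neg_sphere, inner_neg_left] at h2
  linarith

/-- The standard basis vectors, as points of the unit sphere. -/
noncomputable def basisSphere {d : ℕ} (i : Fin d) : USphere d := ⟨EuclideanSpace.single i 1, by simp⟩

theorem inner_basisSphere {d : ℕ} (i : Fin d) (a : Eu d) :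
    inner ℝ (basisSphere i : Eu d) a = a i := by
  simp [basisSphere, EuclideanSpace.inner_single_left]

/-- The vector of the values of `f` at level `0` in the directions of the standard basis. -/
noncomputable def coordVec (d : ℕ) : Cbar d →L[ℝ] Eu d :=
  ((EuclideanSpace.equiv (Fin d) ℝ).symm : (Fin d → ℝ) →L[ℝ] Eu d).comp
    (ContinuousLinearMap.pi fun i => evalFunctional 0 (basisSphere i))

theorem coordVec_apply {d : ℕ} (f : Cbar d) (i : Fin d) :
    coordVec d f i = evalFunctional 0 (basisSphere i) f := rfl

/-! ### Recognizing indicators of points -/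

theorem FuzzyKC.ext {d : ℕ} {μ ν : FuzzyKC d} (h : ∀ x, μ.toFun x = ν.toFun x) : μ = ν := by
  cases μ
  cases ν
  congr
  exact funext h

theorem FuzzyKC.eq_indicator_of_levelSet_subset {d : ℕ} {ν : FuzzyKC d} {a : Eu d}
    (h : ν.levelSet 0 ⊆ {a}) : ν = FuzzyKC.indicator a := by
  rw [ν.levelSet_zero] at h
  refine FuzzyKC.ext fun x => ?_
  by_cases hx : x = a
  -- Normality forces the value `1` at `a`: a point of the `1`-cut exists and lies in the support,
  -- so it is `a`.
  · obtain ⟨y, hy⟩ := ν.nonempty_cut_one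
    have hy1 : ν.toFun y = 1 := hy
    have hya : y = a := h (subset_closure (by simp [hy1]))
    simp [FuzzyKC.indicator, hx, ← hya, hy1]
  · have h0 : ¬ 0 < ν.toFun x := fun hpos => hx (h (subset_closure hpos))
    simpa [FuzzyKC.indicator, hx] using le_antisymm (not_lt.1 h0) (ν.mem_Icc x).1

/-- For `a` in the support and the `i`-th basis vector `e`, one has `-s(-e) ≤ a i ≤ s(e)`. Zero
width makes the two bounds equal, so `a i = s(e)`. -/
theorem FuzzyKC.eq_indicator_of_width_eq_zero {d : ℕ} {ν : FuzzyKC d}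
    (h : ∀ i, (evalFunctional 0 (basisSphere i) + evalFunctional 0 (-basisSphere i)) ν.supp = 0) :
    ν = FuzzyKC.indicator (coordVec d ν.supp) := by
  refine FuzzyKC.eq_indicator_of_levelSet_subset fun a ha => ?_
  refine PiLp.ext fun i => ?_
  have h0 := h i
  have h1 := inner_le_suppC (ν.level 0) (basisSphere i) ha
  have h2 := inner_le_suppC (ν.level 0) (-basisSphere i) ha
  rw [add_apply, evalFunctional_supp, evalFunctional_supp] at h0
  rw [coe_neg_sphere, inner_neg_left, inner_basisSphere] at h2
  rw [inner_basisSphere] at h1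
  rw [coordVec_apply, evalFunctional_supp]
  linarith

theorem FuzzyKC.levelSet_indicator {d : ℕ} (a : Eu d) (α : unitInterval) :
    (FuzzyKC.indicator a).levelSet α = {a} := by
  rcases eq_or_lt_of_le (unitInterval.nonneg' (t := α)) with h | h
  · have : {x | 0 < (FuzzyKC.indicator a).toFun x} = {a} := by
      ext x
      by_cases hx : x = a <;> simp [FuzzyKC.indicator, hx]
    rw [← h, FuzzyKC.levelSet_zero, this, closure_singleton]
  · have h' : (0 : ℝ) < α := h
    rw [FuzzyKC.levelSet_of_pos _ h]
    ext x
    by_cases hx : x = a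
    · simpa [FuzzyKC.indicator, hx] using α.2.2
    · simpa [FuzzyKC.indicator, hx] using h'

theorem evalFunctional_supp_indicator {d : ℕ} (a : Eu d) (α : unitInterval) (x : USphere d) :
    evalFunctional α x (FuzzyKC.indicator a).supp = inner ℝ (x : Eu d) a := by
  show sSup ((fun a : Eu d => inner ℝ (x : Eu d) a) '' (FuzzyKC.indicator a).levelSet α) = _
  rw [FuzzyKC.levelSet_indicator, image_singleton, csSup_singleton]

/-- The embedding of `ℝ^d` into `Cbar d` by support functions of points. -/
noncomputable def pointSupp (d : ℕ) : Eu d →L[ℝ] Cbar d :=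
  LinearMap.toContinuousLinearMap
    { toFun := fun a => (FuzzyKC.indicator a).supp
      map_add' := fun a b => ext_evalFunctional fun α x => by
        simp only [map_add, evalFunctional_supp_indicator, inner_add_right]
      map_smul' := fun c a => ext_evalFunctional fun α x => by
        simp only [map_smul, evalFunctional_supp_indicator, inner_smul_right, RingHom.id_apply,
          smul_eq_mul] }

theorem pointSupp_apply {d : ℕ} (a : Eu d) : pointSupp d a = (FuzzyKC.indicator a).supp := rfl

end FuzzyBM

theorem mainTheorem1 {Ω : Type*} {mΩ : MeasurableSpace Ω} (P : Measure Ω) [IsProbabilityMeasure P]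
    [P.IsComplete] (𝓕 : Filtration ℝ≥0 mΩ) (h𝓕 : FuzzyBM.UsualConditions 𝓕 P) (d : ℕ)
    (B : ℝ≥0 → Ω → FuzzyBM.FuzzyKC d) (hB : FuzzyBM.IsAdaptedFuzzyProcess 𝓕 B) :
    FuzzyBM.IsFuzzyBrownianMotion 𝓕 B P ↔
      ∃ b : ℝ≥0 → Ω → EuclideanSpace ℝ (Fin d), FuzzyBM.IsBrownianMotion b P ∧
        ∀ᵐ ω ∂P, ∀ t, B t ω = FuzzyBM.FuzzyKC.indicator (b t ω) := by
  constructor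
  · rintro ⟨-, hW⟩
    refine ⟨_, hW.map (FuzzyBM.coordVec d), ?_⟩
    -- Finitely many directions suffice, so one null set serves them all.
    have hwidth := ae_all_iff.2 fun i : Fin d => hW.ae_eq_zero_of_nonneg
      (FuzzyBM.evalFunctional 0 (FuzzyBM.basisSphere i) +
        FuzzyBM.evalFunctional 0 (-FuzzyBM.basisSphere i))
      fun t ω => FuzzyBM.suppC_add_suppC_neg_nonneg ((B t ω).level 0) _
    filter_upwards [hwidth] with ω h t
    exact FuzzyBM.FuzzyKC.eq_indicator_of_width_eq_zero fun i => h i t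
  · rintro ⟨b, hb, hBb⟩
    refine ⟨hB, (hb.map (FuzzyBM.pointSupp d)).congr ?_⟩
    filter_upwards [hBb] with ω h t
    rw [h t, FuzzyBM.pointSupp_apply]
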